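/- Let $1\le p\le\infty$. All spaces are real, and $\ell^\infty$ is replaced by $c_0$ throughout when $p=\infty$. A \emph{$p$-multinormed space} is a Banach space $X$ together with a norm $\|\cdot\|_\alpha$ on the algebraic tensor product $\ell^p\otimes X$ such that (1) $\|a\otimes x\|_\alpha=\|a\|\,\|x\|$ for all $a\in\ell^p$, $x\in X$; (2) $|\langle a^*\otimes x^*,u\rangle|\le\|u\|_\alpha$ for all $u\in\ell^p\otimes X$ and all $a^*\in(\ell^p)^*$, $x^*\in X^*$ of norm at most $1$; (3) $\|(T\otimes I_X)u\|_\alpha\le\|T\|\,\|u\|_\alpha$ for all bounded linear $T:\ell^p\to\ell^p$ and $u\in\ell^p\otimes X$. A linear subspace of $X$ inherits the restricted norm. For a linear map $u$ between such spaces (or linear subspaces of them), $\|u\|_p\in[0,\infty]$ denotes the norm of $I_{\ell^p}\otimes u$. For a linearly independent sequence $(x_i)_{i=1}^\infty$ in $X$, the $n$-th basis projection is the linear map $P_n$ from $\mathrm{span}\{x_i : i\geq 1\}$ to itself given by $P_n\big(\sum_i\alpha_i x_i\big)=\sum_{i\le n}\alpha_i x_i$ (finite sums); the sequence is called \emph{$p$-basic}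 if $\sup_n\|P_n\|_p<\infty$. \textbf{Statement.} Let $X$ be an infinite-dimensional $p$-multinormed space and let $(\varepsilon_n)_{n=1}^\infty$ be any sequence of positive real numbers. Then $X$ contains a linearly independent sequence $(x_i)_{i=1}^\infty$ of vectors of norm one such that $\|P_n\|_p\le 1+\varepsilon_n$ for every $n$, and such that $(x_i)_{i=1}^\infty$ is a $p$-basic sequence. -/

import Mathlib

open scoped ENNReal TensorProduct

noncomputable section

namespace Multinorm

/-- The sequence space `ℓ^p`, replaced by `c₀` when `p = ∞`: the sequences in `ℓ^p` which tend to
zero. For `p < ∞` this is all of `ℓ^p` (see `ellP_eq_top`). -/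
def ellP (p : ℝ≥0∞) [Fact (1 ≤ p)] : Submodule ℝ (lp (fun _ : ℕ => ℝ) p) where
  carrier := {a | Filter.Tendsto (fun i => a i) Filter.atTop (nhds 0)}
  add_mem' := by
    intro a b ha hb
    simpa using Filter.Tendsto.add ha hb
  zero_mem' := by
    simp
  smul_mem' := by
    intro c a ha
    simpa using Filter.Tendsto.const_mul c ha

theorem ellP_eq_top (p : ℝ≥0∞) [hp : Fact (1 ≤ p)] (hp' : p ≠ ∞) : ellP p = ⊤ := by
  rw [eq_top_iff]
  intro a _
  have hpos : 0 < p.toReal :=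
    ENNReal.toReal_pos (zero_lt_one.trans_le hp.out).ne' hp'
  have h1 := ((lp.memℓp a).summable hpos).tendsto_atTop_zero
  have h2 := h1.rpow_const (p := p.toReal⁻¹) (Or.inr (inv_nonneg.2 hpos.le))
  rw [Real.zero_rpow (inv_pos.2 hpos).ne'] at h2
  refine squeeze_zero_norm (fun i => ?_) h2
  rw [Real.rpow_rpow_inv (norm_nonneg _) hpos.ne']

/-- A `p`-multinorm on a normed space `X`: a left tensorial cross-norm on the algebraic tensor
product `ℓ^p ⊗ X` (on `c₀ ⊗ X`, when `p = ∞`). -/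
structure PMultinorm (p : ℝ≥0∞) [Fact (1 ≤ p)] (X : Type*) [NormedAddCommGroup X]
    [NormedSpace ℝ X] extends Seminorm ℝ (ellP p ⊗[ℝ] X) where
  eq_zero_of_norm_eq_zero : ∀ u : ellP p ⊗[ℝ] X, toFun u = 0 → u = 0
  norm_tmul : ∀ (a : ellP p) (x : X), toFun (a ⊗ₜ[ℝ] x) = ‖a‖ * ‖x‖
  dual_le : ∀ (f : ellP p →L[ℝ] ℝ) (g : X →L[ℝ] ℝ), ‖f‖ ≤ 1 → ‖g‖ ≤ 1 →
    ∀ u : ellP p ⊗[ℝ] X,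
      |TensorProduct.lid ℝ ℝ (TensorProduct.map f.toLinearMap g.toLinearMap u)| ≤ toFun u
  tensorial : ∀ (T : ellP p →L[ℝ] ellP p) (u : ellP p ⊗[ℝ] X),
    toFun (T.toLinearMap.rTensor X u) ≤ ‖T‖ * toFun u

section

variable {p : ℝ≥0∞} [Fact (1 ≤ p)]
variable {X : Type*} [NormedAddCommGroup X] [NormedSpace ℝ X]
variable {Y : Type*} [NormedAddCommGroup Y] [NormedSpace ℝ Y]

/-- The `p`-multinorm which a linear subspace inherits. -/
def PMultinorm.restrict (α : PMultinorm p X) (W : Submodule ℝ X) : PMultinorm p W where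
  toSeminorm := α.toSeminorm.comp (W.subtype.lTensor (ellP p))
  eq_zero_of_norm_eq_zero := by
    intro u hu
    have h := α.eq_zero_of_norm_eq_zero _ hu
    have hinj : Function.Injective (W.subtype.lTensor (ellP p)) :=
      Module.Flat.lTensor_preserves_injective_linearMap _ W.injective_subtype
    exact hinj (by rw [h, map_zero])
  norm_tmul := by
    intro a x
    exact α.norm_tmul a (x : X)
  dual_le := by
    intro f g hf hg u
    obtain ⟨g', hg', hn⟩ := exists_extension_norm_eq W g
    have h := α.dual_le f g' hf (hn ▸ hg) (W.subtype.lTensor (ellP p) u)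
    have hc : g'.toLinearMap ∘ₗ W.subtype = g.toLinearMap := by
      ext w
      exact hg' w
    have he : TensorProduct.map f.toLinearMap g'.toLinearMap (W.subtype.lTensor (ellP p) u)
        = TensorProduct.map f.toLinearMap g.toLinearMap u := by
      rw [← hc, LinearMap.lTensor, ← LinearMap.comp_apply, ← TensorProduct.map_comp,
        LinearMap.comp_id]
    rw [he] at h
    exact h
  tensorial := by
    intro T u
    have h := α.tensorial T (W.subtype.lTensor (ellP p) u)
    have he : T.toLinearMap.rTensor X (W.subtype.lTensor (ellP p) u)
        = W.subtype.lTensor (ellP p) (T.toLinearMap.rTensor W u) := by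
      rw [← LinearMap.comp_apply, ← LinearMap.comp_apply, LinearMap.rTensor_comp_lTensor,
        LinearMap.lTensor_comp_rTensor]
    rw [he] at h
    exact h

/-- The `p`-norm of a linear map `u : X → Y`: the norm of `I ⊗ u : ℓ^p ⊗ X → ℓ^p ⊗ Y`
(with `c₀` in place of `ℓ^∞` for `p = ∞`), possibly infinite. -/
def pNorm (α : PMultinorm p X) (β : PMultinorm p Y) (u : X →ₗ[ℝ] Y) : ℝ≥0∞ :=
  ⨆ (t : ellP p ⊗[ℝ] X) (_ : α.toSeminorm t ≤ 1),
    ENNReal.ofReal (β.toSeminorm (u.lTensor (ellP p) t))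

/-- The `n`-th basis projection on the linear span of a linearly independent sequence
(indexed from `0`), mapping a finite sum `∑ cᵢ xᵢ` to `∑_{i ≤ n} cᵢ xᵢ`. -/
def basisProj {x : ℕ → X} (hx : LinearIndependent ℝ x) (n : ℕ) :
    Submodule.span ℝ (Set.range x) →ₗ[ℝ] Submodule.span ℝ (Set.range x) :=
  (Module.Basis.span hx).constr ℝ
    (fun i => if i ≤ n then Module.Basis.span hx i else 0)

theorem basisProj_apply {x : ℕ → X} (hx : LinearIndependent ℝ x) (n : ℕ) (s : Finset ℕ)
    (c : ℕ → ℝ) :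
    (basisProj hx n (∑ i ∈ s, c i • Module.Basis.span hx i) : X)
      = ∑ i ∈ s with i ≤ n, c i • x i := by
  simp only [basisProj, map_sum, map_smul, Module.Basis.constr_basis, Finset.sum_filter]
  rw [AddSubmonoidClass.coe_finsetSum]
  refine Finset.sum_congr rfl fun i _ => ?_
  split_ifs <;> simp [Module.Basis.span_apply]

/-- The `p`-norm of the `n`-th basis projection, the span carrying the inherited `p`-multinorm. -/
def basisProjNorm (α : PMultinorm p X) {x : ℕ → X} (hx : LinearIndependent ℝ x) (n : ℕ) :
    ℝ≥0∞ :=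
  pNorm (α.restrict (Submodule.span ℝ (Set.range x)))
    (α.restrict (Submodule.span ℝ (Set.range x))) (basisProj hx n)

/-- A `p`-basic sequence: linearly independent (hence nonzero) vectors whose basis projections
are uniformly `p`-multibounded. -/
def IsPBasicSequence (α : PMultinorm p X) (x : ℕ → X) : Prop :=
  ∃ hx : LinearIndependent ℝ x, ⨆ n, basisProjNorm α hx n < ∞

end

end Multinorm

end

noncomputable section

namespace Multinorm

/-! ### Disjoint blocks and contractive factorizations in `ellP p`. -/

section SequenceSpace

variable {p : ℝ≥0∞} [hp : Fact (1 ≤ p)]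

/-! This is Mazur's construction of basic sequences. Given a finite-dimensional `F`, one seeks `Y`
of finite codimension such that the projection from `F + Y` onto `F` along `Y` has `p`-norm at most
`1 + ε`. Classically, finitely many functionals almost norm `F`, and `Y` is their common kernel.
Here `ℓ^p ⊗ F` is infinite-dimensional, so compactness is lacking.

The remedy is `exists_factorization`. Write a tensor over `F` with coefficients `a_1, …, a_m` and
group the indices `j` by the approximate direction of `(a_1(j), …, a_m(j))` in a finite net. Up to a
small error the `a_i` lie in the span of `N` disjoint blocks, on which the identity factors
contractively through `ℓ^p_N`, with `N` independent of the tensor. By tensoriality some contraction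
`T` into `ℓ^p_N` almost preserves the multinorm of the tensor.

Finitely many functionals `φ` almost norm the finite-dimensional `ℓ^p_N ⊗ F`. Let `Y` be the common
kernel of the maps `x ↦ φ (e_k ⊗ x)`, `k < N`. Then `φ ∘ (T ⊗ I)` vanishes on `ℓ^p ⊗ Y` for every
such `T`, which gives `exists_cofg_almost_orthogonal`. A greedy choice of unit vectors concludes. -/

theorem ellP_ext {x y : ellP p} (h : ∀ j, x.1 j = y.1 j) : x = y :=
  Subtype.ext (lp.ext (funext h))

theorem ellP_norm_mono {x y : ellP p} (h : ∀ j, |x.1 j| ≤ |y.1 j|) : ‖x‖ ≤ ‖y‖ :=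
  lp.norm_mono (zero_lt_one.trans_le hp.out).ne' h

theorem ellP_sum_apply {ι : Type*} (s : Finset ι) (f : ι → ellP p) (j : ℕ) :
    (∑ i ∈ s, f i).1 j = ∑ i ∈ s, (f i).1 j := by
  rw [AddSubmonoidClass.coe_finsetSum, lp.coeFn_sum, Finset.sum_apply]

/-- The space `ellP p` is solid: a sequence dominated by an element of it belongs to it. -/
theorem exists_ellP_of_abs_le (f : ℕ → ℝ) (x : ellP p) (h : ∀ j, |f j| ≤ |x.1 j|) :
    ∃ y : ellP p, ∀ j, y.1 j = f j := by
  refine ⟨⟨⟨f, (lp.memℓp x.1).mono' h⟩, ?_⟩, fun _ => rfl⟩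
  have hx : Filter.Tendsto (fun i => x.1 i) Filter.atTop (nhds 0) := x.2
  exact squeeze_zero_norm h (by simpa using hx.norm)

variable (p) in
/-- The standard unit vectors of `ellP p`. -/
def stdVec (k : ℕ) : ellP p :=
  ⟨lp.single (E := fun _ : ℕ => ℝ) p k 1, tendsto_const_nhds.congr' (by
    filter_upwards [Filter.eventually_gt_atTop k] with j hj
    exact (lp.single_apply_ne (E := fun _ : ℕ => ℝ) p k 1 hj.ne').symm)⟩

theorem stdVec_apply (k j : ℕ) : (stdVec p k).1 j = if j = k then 1 else 0 := by
  simp [stdVec, Pi.single_apply]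

theorem norm_stdVec (k : ℕ) : ‖stdVec p k‖ = 1 := by
  change ‖lp.single (E := fun _ : ℕ => ℝ) p k 1‖ = 1
  rw [lp.norm_single (zero_lt_one.trans_le hp.out), norm_one]

theorem sum_smul_stdVec_apply (N : ℕ) (f : ℕ → ℝ) (j : ℕ) :
    (∑ k ∈ Finset.range N, f k • stdVec p k).1 j = if j < N then f j else 0 := by
  rw [ellP_sum_apply]
  have : ∀ k, (f k • stdVec p k).1 j = if j = k then f k else 0 := by
    intro k
    change f k * (stdVec p k).1 j = _
    rw [stdVec_apply]; simp
  simp only [this]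
  simp

/-- The coordinate functionals of `ellP p`. -/
def coordFun (k : ℕ) : ellP p →L[ℝ] ℝ :=
  LinearMap.mkContinuous
    { toFun := fun x => x.1 k
      map_add' := fun _ _ => rfl
      map_smul' := fun _ _ => rfl } 1 (fun x => by
      rw [one_mul]
      exact lp.norm_apply_le_norm (zero_lt_one.trans_le hp.out).ne' x.1 k)

@[simp] theorem coordFun_apply (k : ℕ) (x : ellP p) : coordFun k x = x.1 k := rfl

theorem exists_maskFun (c : ℕ → ℕ) (k : ℕ) (x : ellP p) :
    ∃ y : ellP p, ∀ j, y.1 j = if c j = k then x.1 j else 0 :=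
  exists_ellP_of_abs_le _ x fun j => by split_ifs <;> simp

/-- The band projection of `ellP p` onto the sequences supported where the colouring `c` takes the
value `k`. -/
def mask (c : ℕ → ℕ) (k : ℕ) : ellP p →L[ℝ] ellP p :=
  LinearMap.mkContinuous
    { toFun := fun x => (exists_maskFun c k x).choose
      map_add' := fun x y => ellP_ext fun j => by
        change _ = (exists_maskFun c k x).choose.1 j + (exists_maskFun c k y).choose.1 j
        simp only [(exists_maskFun c k _).choose_spec]
        split_ifs
        · rfl
        · simp
      map_smul' := fun a x => ellP_ext fun j => by
        change _ = a * (exists_maskFun c k x).choose.1 j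
        simp only [(exists_maskFun c k _).choose_spec]
        split_ifs
        · rfl
        · simp } 1 (fun x => by
    rw [one_mul]
    refine ellP_norm_mono fun j => ?_
    change |(exists_maskFun c k x).choose.1 j| ≤ _
    rw [(exists_maskFun c k x).choose_spec]
    split_ifs <;> simp)

theorem mask_apply (c : ℕ → ℕ) (k : ℕ) (x : ellP p) (j : ℕ) :
    (mask c k x).1 j = if c j = k then x.1 j else 0 :=
  (exists_maskFun c k x).choose_spec j

theorem mask_mask (c : ℕ → ℕ) (k l : ℕ) (x : ellP p) :
    mask c l (mask c k x) = if k = l then mask c k x else 0 := by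
  refine ellP_ext fun j => ?_
  rw [mask_apply, mask_apply]
  by_cases h : k = l
  · subst h
    simp only [if_true, mask_apply]
    split_ifs <;> rfl
  · rw [if_neg h]
    split_ifs with h1 h2
    · exact absurd (h2.symm.trans h1) h
    · rfl
    · rfl

/-- The norm of `ellP p` is computed blockwise. -/
theorem norm_sum_norm_mask (c : ℕ → ℕ) (N : ℕ) (hc : ∀ j, c j < N) (x : ellP p) :
    ‖∑ k ∈ Finset.range N, ‖mask c k x‖ • stdVec p k‖ = ‖x‖ := by
  have hp0 : p ≠ 0 := (zero_lt_one.trans_le hp.out).ne'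
  rcases eq_or_ne p ∞ with rfl | hpt
  · apply le_antisymm
    · refine lp.norm_le_of_forall_le (norm_nonneg x) fun j => ?_
      change ‖(∑ k ∈ Finset.range N, ‖mask c k x‖ • stdVec ∞ k).1 j‖ ≤ _
      rw [sum_smul_stdVec_apply]
      split_ifs
      · rw [norm_norm]
        refine ellP_norm_mono fun i => ?_
        rw [mask_apply]
        split_ifs <;> simp
      · simp
    · refine lp.norm_le_of_forall_le (norm_nonneg _) fun j => ?_
      have h1 := lp.norm_apply_le_norm hp0 (mask c (c j) x).1 j
      rw [mask_apply, if_pos rfl] at h1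
      refine h1.trans ?_
      have h2 := lp.norm_apply_le_norm hp0
        (∑ k ∈ Finset.range N, ‖mask c k x‖ • stdVec ∞ k).1 (c j)
      rw [sum_smul_stdVec_apply, if_pos (hc j), norm_norm] at h2
      exact h2
  · have hpos : 0 < p.toReal := ENNReal.toReal_pos hp0 hpt
    -- For finite `p`, both `p`-th powers equal the sum of the `p`-th powers of the block norms.
    have h1 : ‖∑ k ∈ Finset.range N, ‖mask c k x‖ • stdVec p k‖ ^ p.toReal
        = ∑ k ∈ Finset.range N, ‖mask c k x‖ ^ p.toReal := by
      have := lp.norm_sum_single (E := fun _ : ℕ => ℝ) hpos (fun k => ‖mask c k x‖)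
        (Finset.range N)
      simp only [norm_norm] at this
      rw [← this]
      congr 1
      rw [Submodule.coe_norm, AddSubmonoidClass.coe_finsetSum]
      congr 1
      refine Finset.sum_congr rfl fun k _ => ?_
      change ‖mask c k x‖ • lp.single (E := fun _ : ℕ => ℝ) p k 1 = _
      rw [← lp.single_smul, smul_eq_mul, mul_one]
    have h2 : ∀ k, HasSum (fun j => ‖(mask c k x).1 j‖ ^ p.toReal) (‖mask c k x‖ ^ p.toReal) :=
      fun k => lp.hasSum_norm hpos (mask c k x).1
    have h3 := hasSum_sum fun k (_ : k ∈ Finset.range N) => h2 k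
    have h4 : (fun j => ∑ k ∈ Finset.range N, ‖(mask c k x).1 j‖ ^ p.toReal)
        = fun j => ‖x.1 j‖ ^ p.toReal := by
      funext j
      rw [Finset.sum_eq_single (c j)]
      · rw [mask_apply, if_pos rfl]
      · intro k _ hk
        rw [mask_apply, if_neg hk.symm, norm_zero, Real.zero_rpow hpos.ne']
      · intro h
        exact absurd (Finset.mem_range.2 (hc j)) h
    rw [h4] at h3
    have h5 : ‖x‖ ^ p.toReal = ∑ k ∈ Finset.range N, ‖mask c k x‖ ^ p.toReal :=
      (lp.hasSum_norm hpos x.1).unique h3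
    exact Real.rpow_left_injOn hpos.ne' (norm_nonneg _) (norm_nonneg _) (h1.trans h5.symm)

/-- The unit ball of `ℝ^m` has finite nets, in homogeneous form. -/
theorem exists_finite_directions (m : ℕ) {δ : ℝ} (hδ : 0 < δ) :
    ∃ (N : ℕ) (w : ℕ → Fin m → ℝ), ∀ v : Fin m → ℝ,
      ∃ k < N, ∀ i, |v i - ‖v‖ * w k i| ≤ δ * ‖v‖ := by
  obtain ⟨t, -, ht, hcov⟩ := finite_cover_balls_of_compact
    (isCompact_closedBall (0 : Fin m → ℝ) 1) hδ
  obtain ⟨N, w, hw⟩ : ∃ (N : ℕ) (w : ℕ → Fin m → ℝ), ∀ y ∈ t, ∃ k < N, w k = y := by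
    classical
    let e := ht.toFinset.equivFin
    refine ⟨ht.toFinset.card, fun k => if h : k < ht.toFinset.card then (e.symm ⟨k, h⟩).1 else 0,
      fun y hy => ⟨e ⟨y, ht.mem_toFinset.2 hy⟩, (e _).2, ?_⟩⟩
    simp
  refine ⟨N, w, fun v => ?_⟩
  have hv : ‖v‖⁻¹ • v ∈ Metric.closedBall (0 : Fin m → ℝ) 1 := by
    rw [mem_closedBall_zero_iff, norm_smul, norm_inv, norm_norm]
    exact inv_mul_le_one
  obtain ⟨y, hy, hvy⟩ := Set.mem_iUnion₂.1 (hcov hv)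
  obtain ⟨k, hk, rfl⟩ := hw y hy
  refine ⟨k, hk, fun i => ?_⟩
  rcases eq_or_ne v 0 with rfl | h0
  · simp
  have hn : 0 < ‖v‖ := norm_pos_iff.2 h0
  rw [Metric.mem_ball, dist_eq_norm] at hvy
  have h1 := (norm_le_pi_norm (‖v‖⁻¹ • v - w k) i).trans hvy.le
  have h2 : v i - ‖v‖ * w k i = ‖v‖ * ((‖v‖⁻¹ • v - w k) i) := by
    simp only [Pi.sub_apply, Pi.smul_apply, smul_eq_mul]
    field_simp
  rw [h2, abs_mul, abs_norm, mul_comm]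
  exact mul_le_mul_of_nonneg_right h1 hn.le

/-- Blocks with disjoint supports span a contractively complemented copy of a space
`ℓ^p_N`. -/
theorem exists_factorization_mask (c : ℕ → ℕ) (N : ℕ) (hc : ∀ j, c j < N) (r : ellP p) :
    ∃ S T : ellP p →L[ℝ] ellP p, ‖S‖ ≤ 1 ∧ ‖T‖ ≤ 1 ∧
      (∀ x, T x ∈ Submodule.span ℝ (stdVec p '' Set.Iio N)) ∧
      ∀ k < N, S (T (mask c k r)) = mask c k r := by
  -- `T` reads off block `k` by a functional norming `mask c k r`, and `S` sends `e_k` to that block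
  -- normalized. A zero block is harmless since `0⁻¹ = 0`.
  choose g hg hgr using fun k => exists_dual_vector'' ℝ (mask c k r)
  let S : ellP p →L[ℝ] ellP p := ∑ k ∈ Finset.range N,
    (coordFun k).smulRight (‖mask c k r‖⁻¹ • mask c k r)
  let T : ellP p →L[ℝ] ellP p := ∑ k ∈ Finset.range N,
    ((g k).comp (mask c k)).smulRight (stdVec p k)
  have hS : ∀ x, S x = ∑ k ∈ Finset.range N, x.1 k • ‖mask c k r‖⁻¹ • mask c k r := by
    intro x
    simp [S, _root_.sum_apply]
  have hT : ∀ x, T x = ∑ k ∈ Finset.range N, g k (mask c k x) • stdVec p k := by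
    intro x
    simp [T, _root_.sum_apply]
  refine ⟨S, T, ?_, ?_, ?_, ?_⟩
  · refine ContinuousLinearMap.opNorm_le_bound _ zero_le_one fun x => ?_
    rw [one_mul, ← norm_sum_norm_mask c N hc (S x)]
    refine ellP_norm_mono fun k => ?_
    rw [sum_smul_stdVec_apply]
    split_ifs with hk
    · have h1 : mask c k (S x) = x.1 k • ‖mask c k r‖⁻¹ • mask c k r := by
        rw [hS, map_sum, Finset.sum_eq_single k]
        · rw [map_smul, map_smul, mask_mask, if_pos rfl]
        · intro l _ hl
          rw [map_smul, map_smul, mask_mask, if_neg hl, smul_zero, smul_zero]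
        · intro h
          exact absurd (Finset.mem_range.2 hk) h
      rw [h1, abs_norm, norm_smul, norm_smul, norm_inv, norm_norm, Real.norm_eq_abs]
      exact mul_le_of_le_one_right (abs_nonneg _) inv_mul_le_one
    · simp
  · refine ContinuousLinearMap.opNorm_le_bound _ zero_le_one fun x => ?_
    rw [one_mul, ← norm_sum_norm_mask c N hc x, hT]
    refine ellP_norm_mono fun k => ?_
    rw [sum_smul_stdVec_apply, sum_smul_stdVec_apply]
    split_ifs with hk
    · rw [abs_norm]
      simpa using (g k).le_of_opNorm_le (hg k) (mask c k x)
    · rfl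
  · intro x
    rw [hT]
    exact Submodule.sum_mem _ fun k hk => Submodule.smul_mem _ _
      (Submodule.subset_span ⟨k, Finset.mem_range.1 hk, rfl⟩)
  · intro k hk
    have h1 : T (mask c k r) = ‖mask c k r‖ • stdVec p k := by
      rw [hT, Finset.sum_eq_single k]
      · rw [mask_mask, if_pos rfl, hgr]
        rfl
      · intro l _ hl
        rw [mask_mask, if_neg (Ne.symm hl), map_zero, zero_smul]
      · intro h
        exact absurd (Finset.mem_range.2 hk) h
    have h2 : S (stdVec p k) = ‖mask c k r‖⁻¹ • mask c k r := by
      rw [hS, Finset.sum_eq_single k]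
      · rw [stdVec_apply, if_pos rfl, one_smul]
      · intro l _ hl
        rw [stdVec_apply, if_neg hl, zero_smul]
      · intro h
        exact absurd (Finset.mem_range.2 hk) h
    rw [h1, map_smul, h2, smul_smul]
    rcases eq_or_ne (mask c k r) 0 with h0 | h0
    · rw [h0, smul_zero]
    · rw [mul_inv_cancel₀ (norm_ne_zero_iff.2 h0), one_smul]

/-- Any `m` elements of `ellP p` are, up to a small error, fixed by an operator which factors
contractively through `ℓ^p_N`, where `N` depends only on `m` and the error. -/
theorem exists_factorization (m : ℕ) {δ : ℝ} (hδ : 0 < δ) :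
    ∃ N : ℕ, ∀ a : Fin m → ellP p, ∃ S T : ellP p →L[ℝ] ellP p, ‖S‖ ≤ 1 ∧ ‖T‖ ≤ 1 ∧
      (∀ x, T x ∈ Submodule.span ℝ (stdVec p '' Set.Iio N)) ∧
      ∀ i, ‖a i - S (T (a i))‖ ≤ δ * ∑ l, ‖a l‖ := by
  obtain ⟨N, w, hw⟩ := exists_finite_directions m (half_pos hδ)
  refine ⟨N, fun a => ?_⟩
  -- The colour of `j` is a net point approximating the direction of `(a i j)_i`.
  choose c hcN hc using fun j => hw fun i => (a i).1 j
  choose A hA using fun i => exists_ellP_of_abs_le (fun j => |(a i).1 j|) (a i)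
    (fun j => (abs_abs _).le)
  have hAn : ∀ i, ‖A i‖ ≤ ‖a i‖ := fun i => ellP_norm_mono fun j => by rw [hA, abs_abs]
  -- `r j` is the maximum of `|a i j|` over `i`, so `a i j` is close to `w (c j) i * r j`.
  obtain ⟨r, hr⟩ := exists_ellP_of_abs_le (fun j => ‖fun i => (a i).1 j‖) (∑ i, A i) (by
    intro j
    rw [abs_norm, ellP_sum_apply]
    simp only [hA]
    refine le_trans ?_ (le_abs_self _)
    refine (pi_norm_le_iff_of_nonneg (by positivity)).2 fun i => ?_
    exact Finset.single_le_sum (f := fun i => |(a i).1 j|) (fun _ _ => abs_nonneg _)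
      (Finset.mem_univ i))
  have hrn : ‖r‖ ≤ ∑ l, ‖a l‖ := by
    refine le_trans (ellP_norm_mono (y := ∑ i, A i) fun j => ?_)
      ((norm_sum_le _ _).trans (Finset.sum_le_sum fun i _ => hAn i))
    rw [hr, abs_norm, ellP_sum_apply]
    simp only [hA]
    refine le_trans ?_ (le_abs_self _)
    refine (pi_norm_le_iff_of_nonneg (by positivity)).2 fun i => ?_
    exact Finset.single_le_sum (f := fun i => |(a i).1 j|) (fun _ _ => abs_nonneg _)
      (Finset.mem_univ i)
  obtain ⟨S, T, hS, hT, hTN, hST⟩ := exists_factorization_mask c N hcN r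
  refine ⟨S, T, hS, hT, hTN, fun i => ?_⟩
  let b : ellP p := ∑ k ∈ Finset.range N, w k i • mask c k r
  have hb : S (T b) = b := by
    simp only [b, map_sum, map_smul]
    exact Finset.sum_congr rfl fun k hk => by rw [hST k (Finset.mem_range.1 hk)]
  have hbj : ∀ j, b.1 j = w (c j) i * r.1 j := by
    intro j
    simp only [b]
    rw [ellP_sum_apply, Finset.sum_eq_single (c j)]
    · change w (c j) i * (mask c (c j) r).1 j = _
      rw [mask_apply, if_pos rfl]
    · intro k _ hk
      change w k i * (mask c k r).1 j = _
      rw [mask_apply, if_neg hk.symm, mul_zero]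
    · intro h
      exact absurd (Finset.mem_range.2 (hcN j)) h
  have hab : ‖a i - b‖ ≤ δ / 2 * ‖r‖ := by
    have h : ‖a i - b‖ ≤ ‖(δ / 2) • r‖ := by
      refine ellP_norm_mono fun j => ?_
      change |(a i).1 j - b.1 j| ≤ |δ / 2 * r.1 j|
      rw [hbj, hr, mul_comm (w _ _), abs_of_nonneg (mul_nonneg (half_pos hδ).le (norm_nonneg _))]
      exact hc j i
    rwa [norm_smul, Real.norm_of_nonneg (half_pos hδ).le] at h
  have hcontr : ∀ x, ‖S (T x)‖ ≤ ‖x‖ := fun x => by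
    have h1 := S.le_of_opNorm_le hS (T x)
    have h2 := T.le_of_opNorm_le hT x
    linarith
  -- Since `b` is fixed by the contraction `S ∘ T`, the error `δ / 2` is incurred twice.
  have h1 : a i - S (T (a i)) = (a i - b) - S (T (a i - b)) := by
    rw [map_sub, map_sub, hb]; abel
  rw [h1]
  have h2 := norm_sub_le (a i - b) (S (T (a i - b)))
  have h3 := hcontr (a i - b)
  have h4 := mul_le_mul_of_nonneg_left hrn hδ.le
  linarith

end SequenceSpace

/-! ### Almost norming finite-dimensional subspaces. -/

/-- A finite-dimensional subspace of a normed space is almost normed by finitely many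
functionals of norm at most one. -/
theorem exists_finite_almost_norming {E : Type*} [NormedAddCommGroup E] [NormedSpace ℝ E]
    (V : Submodule ℝ E) [FiniteDimensional ℝ V] {η : ℝ} (hη : 0 < η) :
    ∃ Φ : Set (E →L[ℝ] ℝ), Φ.Finite ∧ (∀ φ ∈ Φ, ‖φ‖ ≤ 1) ∧
      ∀ v ∈ V, ∀ C, 0 ≤ C → (∀ φ ∈ Φ, |φ v| ≤ C) → (1 - η) * ‖v‖ ≤ C := by
  obtain ⟨t, -, ht, hcov⟩ := finite_cover_balls_of_compact
    (isCompact_closedBall (0 : V) 1) (half_pos hη)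
  choose g hg hgv using fun v : V => exists_dual_vector'' ℝ (v : E)
  refine ⟨g '' t, ht.image g, ?_, ?_⟩
  · rintro _ ⟨v, -, rfl⟩
    exact hg v
  intro v hv C hC0 hC
  rcases eq_or_ne v 0 with rfl | h0
  · simpa using hC0
  have hn : 0 < ‖v‖ := norm_pos_iff.2 h0
  let u : V := ‖v‖⁻¹ • ⟨v, hv⟩
  have hu1 : ‖u‖ = 1 := by
    change ‖‖v‖⁻¹ • v‖ = 1
    rw [norm_smul, norm_inv, norm_norm, inv_mul_cancel₀ hn.ne']
  obtain ⟨y, hy, huy⟩ := Set.mem_iUnion₂.1 (hcov (mem_closedBall_zero_iff.2 hu1.le))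
  rw [Metric.mem_ball, dist_eq_norm] at huy
  have h1 : |g y ((u : E) - y)| ≤ ‖u - y‖ := by
    simpa using (g y).le_of_opNorm_le (hg y) ((u : E) - y)
  have h2 : ‖u‖ ≤ ‖y‖ + ‖u - y‖ := by simpa using norm_add_le y (u - y)
  have h3 : g y (y : E) = ‖y‖ := hgv y
  rw [map_sub, h3] at h1
  have h4 : ‖v‖ * g y u = g y v := by
    rw [← smul_eq_mul, ← map_smul]
    congr 1
    change ‖v‖ • ‖v‖⁻¹ • v = v
    rw [smul_smul, mul_inv_cancel₀ hn.ne', one_smul]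
  have h5 := (abs_le.1 h1).1
  -- `g y u ≥ ‖y‖ - ‖u - y‖ ≥ 1 - 2 ‖u - y‖`, which explains the net radius `η / 2`.
  have h6 : 1 - η ≤ g y u := by linarith
  have h7 := (le_abs_self _).trans (hC (g y) ⟨y, hy, rfl⟩)
  rw [← h4] at h7
  nlinarith

/-- A seminorm with trivial kernel is a norm, so it suffices to equip `E` with it locally. The
intended `q` is the multinorm on the algebraic tensor product. -/
theorem exists_finite_almost_norming_seminorm {E : Type*} [AddCommGroup E] [Module ℝ E]
    (q : Seminorm ℝ E) (hq : ∀ x, q x = 0 → x = 0)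
    (V : Submodule ℝ E) [FiniteDimensional ℝ V] {η : ℝ} (hη : 0 < η) :
    ∃ Φ : Set (E →ₗ[ℝ] ℝ), Φ.Finite ∧ (∀ φ ∈ Φ, ∀ x, |φ x| ≤ q x) ∧
      ∀ v ∈ V, ∀ C, 0 ≤ C → (∀ φ ∈ Φ, |φ v| ≤ C) → (1 - η) * q v ≤ C := by
  let : Norm E := ⟨q⟩
  have core : NormedSpace.Core ℝ E :=
    { norm_nonneg := apply_nonneg q
      norm_smul := map_smul_eq_mul q
      norm_triangle := map_add_le_add q
      norm_eq_zero_iff := fun x => ⟨hq x, fun h => by rw [h]; exact map_zero q⟩ }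
  let : NormedAddCommGroup E := NormedAddCommGroup.ofCore core
  let : NormedSpace ℝ E := NormedSpace.ofCore core
  obtain ⟨Φ, hΦ, hΦ1, hΦV⟩ := exists_finite_almost_norming V hη
  refine ⟨(fun φ : E →L[ℝ] ℝ => (φ : E →ₗ[ℝ] ℝ)) '' Φ, hΦ.image _, ?_, ?_⟩
  · rintro _ ⟨φ, hφ, rfl⟩ x
    have := φ.le_of_opNorm_le (hΦ1 φ hφ) x
    rw [one_mul] at this
    exact this
  · intro v hv C hC0 hC
    exact hΦV v hv C hC0 fun φ hφ => hC _ ⟨φ, hφ, rfl⟩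

/-! ### Mazur's lemma for `p`-multinorms. -/

section Mazur

variable {p : ℝ≥0∞} [hp : Fact (1 ≤ p)]
variable {X : Type*} [NormedAddCommGroup X] [NormedSpace ℝ X]

theorem PMultinorm.dual_le_norm_mul (α : PMultinorm p X) (f : ellP p →L[ℝ] ℝ) (g : X →L[ℝ] ℝ)
    (hf : ‖f‖ ≤ 1) (u : ellP p ⊗[ℝ] X) :
    |TensorProduct.lid ℝ ℝ (TensorProduct.map f.toLinearMap g.toLinearMap u)|
      ≤ ‖g‖ * α.toSeminorm u := by
  rcases eq_or_ne g 0 with rfl | h0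
  · simp
  have hn : 0 < ‖g‖ := norm_pos_iff.2 h0
  have h := α.dual_le f (‖g‖⁻¹ • g) hf (by
    rw [norm_smul, norm_inv, norm_norm, inv_mul_cancel₀ hn.ne']) u
  have he : (‖g‖⁻¹ • g).toLinearMap = ‖g‖⁻¹ • g.toLinearMap := rfl
  rw [he, TensorProduct.map_smul_right, LinearMap.smul_apply, map_smul, smul_eq_mul, abs_mul,
    abs_inv, abs_norm, inv_mul_le_iff₀ hn] at h
  exact h

theorem PMultinorm.tensorial_of_norm_le_one (α : PMultinorm p X) {T : ellP p →L[ℝ] ellP p}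
    (hT : ‖T‖ ≤ 1) (u : ellP p ⊗[ℝ] X) :
    α.toSeminorm (T.toLinearMap.rTensor X u) ≤ α.toSeminorm u :=
  (α.tensorial T u).trans (mul_le_of_le_one_left (apply_nonneg α.toSeminorm u) hT)

/-- A tensor over a finite-dimensional space is a combination of basis vectors. -/
theorem exists_eq_sum_tmul {A M ι : Type*} [AddCommGroup A] [Module ℝ A] [AddCommGroup M]
    [Module ℝ M] [Fintype ι] (b : Module.Basis ι ℝ M) (u : A ⊗[ℝ] M) :
    ∃ a : ι → A, u = ∑ i, a i ⊗ₜ[ℝ] b i := by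
  induction u using TensorProduct.induction_on with
  | zero => exact ⟨0, by simp⟩
  | tmul x y =>
    refine ⟨fun i => b.repr y i • x, ?_⟩
    conv_lhs => rw [← b.sum_repr y]
    rw [TensorProduct.tmul_sum]
    exact Finset.sum_congr rfl fun i _ => by rw [TensorProduct.smul_tmul]
  | add u v hu hv =>
    obtain ⟨a, rfl⟩ := hu
    obtain ⟨a', rfl⟩ := hv
    exact ⟨a + a', by simp [TensorProduct.add_tmul, Finset.sum_add_distrib]⟩

/-- Over a finite-dimensional subspace, the `p`-multinorm is almost determined by finitely many
coordinates. -/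
theorem PMultinorm.exists_almost_isometric_compression (α : PMultinorm p X) (F : Submodule ℝ X)
    [FiniteDimensional ℝ F] {η : ℝ} (hη : 0 < η) :
    ∃ N : ℕ, ∀ u : ellP p ⊗[ℝ] F, ∃ T : ellP p →L[ℝ] ellP p, ‖T‖ ≤ 1 ∧
      (∀ x, T x ∈ Submodule.span ℝ (stdVec p '' Set.Iio N)) ∧
      (1 - η) * α.toSeminorm (F.subtype.lTensor (ellP p) u)
        ≤ α.toSeminorm (T.toLinearMap.rTensor X (F.subtype.lTensor (ellP p) u)) := by
  let b := Module.finBasis ℝ F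
  have hcoord : ∀ i, ∃ g : X →L[ℝ] ℝ, ∀ y : F, g y = b.coord i y := fun i => by
    obtain ⟨g, hg, -⟩ := exists_extension_norm_eq F (LinearMap.toContinuousLinearMap (b.coord i))
    exact ⟨g, hg⟩
  choose g hg using hcoord
  let C := ∑ i, ‖g i‖
  let D := ∑ i, ‖b i‖
  have hC : 0 ≤ C := by positivity
  have hD : 0 ≤ D := by positivity
  -- The total error will be at most `δ * C * D` times the norm of `z`. The `+ 1` keeps the
  -- denominator positive when `F` is zero.
  have hδ : 0 < η / (C * D + 1) := by positivity
  obtain ⟨N, hN⟩ := exists_factorization (p := p) (Module.finrank ℝ F) hδ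
  refine ⟨N, fun u => ?_⟩
  obtain ⟨a, rfl⟩ := exists_eq_sum_tmul b u
  obtain ⟨S, T, hS, hT, hTN, hST⟩ := hN a
  refine ⟨T, hT, hTN, ?_⟩
  set z := F.subtype.lTensor (ellP p) (∑ i, a i ⊗ₜ[ℝ] b i) with hz
  have hzs : z = ∑ i, a i ⊗ₜ[ℝ] (b i : X) := by simp [hz]
  -- Testing against `f ⊗ g i`, with `g i` biorthogonal to the basis, isolates the `i`-th
  -- coefficient.
  have ha : ∀ i, ‖a i‖ ≤ ‖g i‖ * α.toSeminorm z := by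
    intro i
    obtain ⟨f, hf, hfa⟩ := exists_dual_vector'' ℝ (a i)
    have h := α.dual_le_norm_mul f (g i) hf z
    have he : TensorProduct.lid ℝ ℝ (TensorProduct.map f.toLinearMap (g i).toLinearMap z)
        = ‖a i‖ := by
      rw [hzs, map_sum, map_sum, Finset.sum_eq_single i]
      · simp [hg, hfa]
      · intro l _ hl
        simp [hg, hl]
      · intro h
        exact absurd (Finset.mem_univ i) h
    rwa [he, abs_norm] at h
  have hsum : ∑ l, ‖a l‖ ≤ C * α.toSeminorm z := by
    rw [Finset.sum_mul]
    exact Finset.sum_le_sum fun i _ => ha i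
  have herr : α.toSeminorm (z - S.toLinearMap.rTensor X (T.toLinearMap.rTensor X z))
      ≤ η * α.toSeminorm z := by
    have h1 : z - S.toLinearMap.rTensor X (T.toLinearMap.rTensor X z)
        = ∑ i, (a i - S (T (a i))) ⊗ₜ[ℝ] (b i : X) := by
      rw [hzs]
      simp [TensorProduct.sub_tmul]
    rw [h1]
    calc α.toSeminorm (∑ i, (a i - S (T (a i))) ⊗ₜ[ℝ] (b i : X))
        ≤ ∑ i, α.toSeminorm ((a i - S (T (a i))) ⊗ₜ[ℝ] (b i : X)) :=
          Finset.le_sum_of_subadditive α.toSeminorm (map_zero _).le (map_add_le_add _) _ _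
      _ = ∑ i, ‖a i - S (T (a i))‖ * ‖b i‖ :=
          Finset.sum_congr rfl fun i _ => α.norm_tmul _ _
      _ ≤ ∑ i, (η / (C * D + 1) * (C * α.toSeminorm z)) * ‖b i‖ :=
          Finset.sum_le_sum fun i _ => mul_le_mul_of_nonneg_right
            ((hST i).trans (mul_le_mul_of_nonneg_left hsum hδ.le)) (norm_nonneg _)
      _ = η / (C * D + 1) * (C * D) * α.toSeminorm z := by
          rw [← Finset.mul_sum]; ring
      _ ≤ η * α.toSeminorm z := by
          refine mul_le_mul_of_nonneg_right ?_ (apply_nonneg _ _)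
          rw [div_mul_eq_mul_div, div_le_iff₀ (by positivity)]
          exact mul_le_mul_of_nonneg_left (by linarith) hη.le
  have h2 := map_add_le_add α.toSeminorm
    (z - S.toLinearMap.rTensor X (T.toLinearMap.rTensor X z))
    (S.toLinearMap.rTensor X (T.toLinearMap.rTensor X z))
  rw [sub_add_cancel] at h2
  have h3 := α.tensorial_of_norm_le_one hS (T.toLinearMap.rTensor X z)
  linarith

/-- Mazur's lemma for `p`-multinorms. -/
theorem PMultinorm.exists_cofg_almost_orthogonal (α : PMultinorm p X) (F : Submodule ℝ X)
    [FiniteDimensional ℝ F] {ε : ℝ} (hε : 0 < ε) :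
    ∃ Y : Submodule ℝ X, Y.CoFG ∧ ∀ (u : ellP p ⊗[ℝ] F) (v : ellP p ⊗[ℝ] Y),
      α.toSeminorm (F.subtype.lTensor (ellP p) u) ≤ (1 + ε) *
        α.toSeminorm (F.subtype.lTensor (ellP p) u + Y.subtype.lTensor (ellP p) v) := by
  -- Chosen so that `(1 + ε) * (1 - 2 * η) = 1`, hence `(1 + ε) * (1 - η) ^ 2 ≥ 1`. One factor `1 -
  -- η` is lost in compressing, the other in norming.
  let η := ε / (2 * (1 + ε))
  have hη : 0 < η := by positivity
  have hηε : 2 * η * (1 + ε) = ε := by simp only [η]; field_simp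
  obtain ⟨N, hN⟩ := α.exists_almost_isometric_compression F hη
  let P : Submodule ℝ (ellP p) := Submodule.span ℝ (stdVec p '' Set.Iio N)
  let V : Submodule ℝ (ellP p ⊗[ℝ] X) := Submodule.map₂ (TensorProduct.mk ℝ (ellP p) X) P F
  have hV : FiniteDimensional ℝ V := by
    refine Module.Finite.iff_fg.2 (Submodule.FG.map₂ _ ?_ (Module.Finite.iff_fg.1 inferInstance))
    exact Submodule.fg_span ((Set.finite_Iio N).image _)
  obtain ⟨Φ, hΦ, hΦ1, hΦV⟩ := exists_finite_almost_norming_seminorm α.toSeminorm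
    α.eq_zero_of_norm_eq_zero V hη
  let K : (ellP p ⊗[ℝ] X →ₗ[ℝ] ℝ) → ℕ → Submodule ℝ X := fun φ k =>
    LinearMap.ker (φ ∘ₗ TensorProduct.mk ℝ (ellP p) X (stdVec p k))
  obtain ⟨Y, hY⟩ : ∃ Y, Y = sInf (Set.image2 K Φ (Set.Iio N)) := ⟨_, rfl⟩
  refine ⟨Y, ?_, ?_⟩
  · rw [hY]
    refine Submodule.CoFG.sInf_of_finite (hΦ.image2 _ (Set.finite_Iio N)) ?_
    rintro _ ⟨φ, -, k, -, rfl⟩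
    exact Submodule.CoFG.ker _
  intro u v
  obtain ⟨T, hT, hTP, hTu⟩ := hN u
  set z := F.subtype.lTensor (ellP p) u with hz
  set y := Y.subtype.lTensor (ellP p) v with hy
  have hzV : T.toLinearMap.rTensor X z ∈ V := by
    have : ∀ w : ellP p ⊗[ℝ] F,
        T.toLinearMap.rTensor X (F.subtype.lTensor (ellP p) w) ∈ V := by
      intro w
      induction w using TensorProduct.induction_on with
      | zero => simp
      | tmul a x => exact Submodule.apply_mem_map₂ _ (hTP a) x.2
      | add w w' h h' => rw [map_add, map_add]; exact V.add_mem h h'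
    exact this u
  have hφy : ∀ φ ∈ Φ, φ (T.toLinearMap.rTensor X y) = 0 := by
    intro φ hφ
    have : ∀ w : ellP p ⊗[ℝ] Y,
        φ (T.toLinearMap.rTensor X (Y.subtype.lTensor (ellP p) w)) = 0 := by
      intro w
      induction w using TensorProduct.induction_on with
      | zero => simp
      | tmul a x =>
        have hle : P ≤ LinearMap.ker (φ ∘ₗ (TensorProduct.mk ℝ (ellP p) X).flip (x : X)) := by
          refine Submodule.span_le.2 ?_
          rintro _ ⟨k, hk, rfl⟩
          have := Submodule.mem_sInf.1 (hY.le x.2) _ ⟨φ, hφ, k, hk, rfl⟩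
          exact this
        exact hle (hTP a)
      | add w w' h h' => rw [map_add, map_add, map_add, h, h', add_zero]
    exact this v
  have h1 : (1 - η) * α.toSeminorm (T.toLinearMap.rTensor X z) ≤ α.toSeminorm (z + y) := by
    refine hΦV _ hzV _ (apply_nonneg _ _) fun φ hφ => ?_
    have h := (hΦ1 φ hφ (T.toLinearMap.rTensor X (z + y))).trans
      (α.tensorial_of_norm_le_one hT _)
    rwa [map_add, map_add, hφy φ hφ, add_zero] at h
  have h0 : 0 ≤ α.toSeminorm z := apply_nonneg _ _
  have hη1 : 0 ≤ 1 - η := by nlinarith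
  have h2 : (1 - η) * ((1 - η) * α.toSeminorm z) ≤ α.toSeminorm (z + y) :=
    (mul_le_mul_of_nonneg_left hTu hη1).trans h1
  have h3 : 1 ≤ (1 + ε) * ((1 - η) * (1 - η)) := by
    nlinarith [mul_nonneg (sq_nonneg η) (by linarith : (0 : ℝ) ≤ 1 + ε)]
  calc α.toSeminorm z ≤ (1 + ε) * ((1 - η) * (1 - η)) * α.toSeminorm z :=
        le_mul_of_one_le_left h0 h3
    _ = (1 + ε) * ((1 - η) * ((1 - η) * α.toSeminorm z)) := by ring
    _ ≤ (1 + ε) * α.toSeminorm (z + y) := mul_le_mul_of_nonneg_left h2 (by linarith)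

end Mazur

/-! ### From almost orthogonality to basic sequences. -/

section BasicSequence

variable {p : ℝ≥0∞} [hp : Fact (1 ≤ p)]
variable {X : Type*} [NormedAddCommGroup X] [NormedSpace ℝ X]

/-- `Y` is almost orthogonal to `F`: the projection from `F + Y` onto `F` with kernel `Y` has
`p`-norm at most `1 + ε`. -/
def PMultinorm.AlmostOrthogonal (α : PMultinorm p X) (ε : ℝ) (F Y : Submodule ℝ X) : Prop :=
  ∀ (u : ellP p ⊗[ℝ] F) (v : ellP p ⊗[ℝ] Y),
    α.toSeminorm (F.subtype.lTensor (ellP p) u) ≤ (1 + ε) *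
      α.toSeminorm (F.subtype.lTensor (ellP p) u + Y.subtype.lTensor (ellP p) v)

/-- For `x` in both subspaces, `e_0 ⊗ x` and its negative cancel, which forces `‖x‖ ≤ 0`. This
yields linear independence of the chosen vectors. -/
theorem PMultinorm.AlmostOrthogonal.disjoint {α : PMultinorm p X} {ε : ℝ} {F Y : Submodule ℝ X}
    (h : α.AlmostOrthogonal ε F Y) : Disjoint F Y := by
  refine Submodule.disjoint_def.2 fun x hF hY => ?_
  have h1 := h (stdVec p 0 ⊗ₜ ⟨x, hF⟩) (-(stdVec p 0 ⊗ₜ ⟨x, hY⟩))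
  have h2 : α.toSeminorm (stdVec p 0 ⊗ₜ[ℝ] x) = ‖x‖ := by
    refine (α.norm_tmul _ _).trans ?_
    rw [norm_stdVec, one_mul]
  simp only [LinearMap.lTensor_tmul, Submodule.subtype_apply, map_neg,
    add_neg_cancel, map_zero, mul_zero, h2] at h1
  exact norm_le_zero_iff.1 h1

theorem exists_lTensor_subtype_eq {A M : Type*} [AddCommGroup A] [Module ℝ A] [AddCommGroup M]
    [Module ℝ M] (G : M →ₗ[ℝ] X) (F : Submodule ℝ X) (hG : ∀ m, G m ∈ F) (t : A ⊗[ℝ] M) :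
    ∃ u : A ⊗[ℝ] F, F.subtype.lTensor A u = G.lTensor A t :=
  ⟨(G.codRestrict F hG).lTensor A t, by
    rw [← LinearMap.comp_apply, ← LinearMap.lTensor_comp, LinearMap.subtype_comp_codRestrict]⟩

/-- If the first vectors of a sequence lie in `F` and the others in a subspace almost orthogonal
to `F`, then the basis projection is controlled. -/
theorem PMultinorm.AlmostOrthogonal.basisProjNorm_le {α : PMultinorm p X} {ε : ℝ} (hε : 0 ≤ ε)
    {F Y : Submodule ℝ X} (h : α.AlmostOrthogonal ε F Y) {x : ℕ → X}
    (hx : LinearIndependent ℝ x) (n : ℕ) (hF : ∀ i ≤ n, x i ∈ F) (hY : ∀ i, n < i → x i ∈ Y) :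
    basisProjNorm α hx n ≤ ENNReal.ofReal (1 + ε) := by
  set W := Submodule.span ℝ (Set.range x)
  let b := Module.Basis.span hx
  have hb : ∀ i, (b i : X) = x i := fun i => by
    rw [Module.Basis.span_apply hx i]
  have hmem : ∀ (G : W →ₗ[ℝ] X) (S : Submodule ℝ X), (∀ i, G (b i) ∈ S) → ∀ w, G w ∈ S := by
    intro G S hGS w
    have hle : Submodule.span ℝ (Set.range b) ≤ S.comap G :=
      Submodule.span_le.2 (by rintro _ ⟨i, rfl⟩; exact hGS i)
    rw [b.span_eq] at hle
    exact hle Submodule.mem_top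
  have hproj : ∀ i, basisProj hx n (b i) = if i ≤ n then b i else 0 := fun i => by
    simp only [basisProj, b, Module.Basis.constr_basis]
  refine iSup₂_le fun t ht => ENNReal.ofReal_le_ofReal ?_
  change α.toSeminorm (W.subtype.lTensor (ellP p) t) ≤ 1 at ht
  change α.toSeminorm (W.subtype.lTensor (ellP p) ((basisProj hx n).lTensor (ellP p) t)) ≤ _
  -- `u` and `v` are the components of `t` under the projection and its complement, so they add up
  -- to `t`.
  obtain ⟨u, hu⟩ := exists_lTensor_subtype_eq (A := ellP p) (W.subtype ∘ₗ basisProj hx n) F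
    (hmem _ _ fun i => by
      rw [LinearMap.comp_apply, hproj]
      split_ifs with hi
      · simpa [hb] using hF i hi
      · simp) t
  obtain ⟨v, hv⟩ := exists_lTensor_subtype_eq (A := ellP p)
    (W.subtype ∘ₗ (LinearMap.id - basisProj hx n)) Y
    (hmem _ _ fun i => by
      rw [LinearMap.comp_apply, LinearMap.sub_apply, hproj]
      split_ifs with hi
      · simp
      · simpa [hb] using hY i (not_le.1 hi)) t
  have huv := h u v
  rw [hu, hv, ← LinearMap.add_apply, ← LinearMap.lTensor_add, ← LinearMap.comp_add,
    add_sub_cancel, LinearMap.comp_id, LinearMap.lTensor_comp, LinearMap.comp_apply] at huv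
  exact huv.trans (mul_le_of_le_one_right (by linarith) ht)

theorem linearIndependent_of_notMem_span {x : ℕ → X}
    (h : ∀ n, x n ∉ Submodule.span ℝ (x '' Set.Iio n)) : LinearIndependent ℝ x := by
  have hn : ∀ n, LinearIndepOn ℝ x (Set.Iio n) := by
    intro n
    induction n with
    | zero => simp
    | succ n ih =>
      have : Set.Iio (n + 1) = insert n (Set.Iio n) := by
        ext i; simp only [Set.mem_Iio, Set.mem_insert_iff]; omega
      rw [this]
      exact ih.insert (h n)
  have hU := linearIndepOn_iUnion_of_directed
    (Monotone.directed_le fun m n hmn => Set.Iio_subset_Iio hmn) hn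
  have : (⋃ n, Set.Iio n : Set ℕ) = Set.univ :=
    Set.eq_univ_of_forall fun n => Set.mem_iUnion.2 ⟨n + 1, Nat.lt_succ_self n⟩
  rwa [this, linearIndepOn_univ_iff] at hU

theorem exists_norm_eq_one_of_cofg (hX : ¬ FiniteDimensional ℝ X) (W : Submodule ℝ X)
    (hW : W.CoFG) : ∃ x ∈ W, ‖x‖ = 1 := by
  have hne : W ≠ ⊥ := by
    rintro rfl
    exact hX ((Module.Finite.iff_cofg_bot ℝ X).1 hW)
  obtain ⟨y, hy, hy0⟩ := Submodule.exists_mem_ne_zero_of_ne_bot hne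
  exact ⟨‖y‖⁻¹ • y, W.smul_mem _ hy, by
    rw [norm_smul, norm_inv, norm_norm, inv_mul_cancel₀ (norm_ne_zero_iff.2 hy0)]⟩

/-- Greedy choice of vectors in successive subspaces of finite codimension. -/
theorem exists_seq_almostOrthogonal (hX : ¬ FiniteDimensional ℝ X) (α : PMultinorm p X)
    (ε : ℕ → ℝ) (hε : ∀ n, 0 < ε n) :
    ∃ (x : ℕ → X) (F W : ℕ → Submodule ℝ X), (∀ n, ‖x n‖ = 1) ∧
      (∀ n, α.AlmostOrthogonal (ε n) (F n) (W n)) ∧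
      (∀ n, ∀ i ≤ n, x i ∈ F n) ∧ (∀ n, ∀ i, n < i → x i ∈ W n) := by
  classical
  choose pick hpick hpick1 using exists_norm_eq_one_of_cofg hX
  have hperp : ∀ (F : {F : Submodule ℝ X // FiniteDimensional ℝ F}) (n : ℕ),
      ∃ Y : Submodule ℝ X, Y.CoFG ∧ α.AlmostOrthogonal (ε n) F.1 Y := fun F n =>
    haveI := F.2
    α.exists_cofg_almost_orthogonal F.1 (hε n)
  choose perp hperp hperpF using hperp
  let vec : {F : Submodule ℝ X // FiniteDimensional ℝ F} × {W : Submodule ℝ X // W.CoFG} → X :=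
    fun s => pick s.2.1 s.2.2
  let next : (s : {F : Submodule ℝ X // FiniteDimensional ℝ F} × {W : Submodule ℝ X // W.CoFG}) →
      {F : Submodule ℝ X // FiniteDimensional ℝ F} := fun s =>
    ⟨s.1.1 ⊔ Submodule.span ℝ {vec s}, haveI := s.1.2; inferInstance⟩
  -- `st n` pairs the span of `x_0, …, x_{n-1}` with the intersection of the subspaces chosen so
  -- far, from which `x_n = vec (st n)` is picked. The next subspace is taken almost orthogonal to
  -- the span including `x_n`.
  let st : ℕ → {F : Submodule ℝ X // FiniteDimensional ℝ F} × {W : Submodule ℝ X // W.CoFG} :=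
    fun n => Nat.rec (⟨⊥, inferInstance⟩, ⟨⊤, Submodule.CoFG.top⟩)
      (fun n s => (next s, ⟨s.2.1 ⊓ perp (next s) n, s.2.2.inf (hperp _ _)⟩)) n
  have hF1 : ∀ n, (st (n + 1)).1 = next (st n) := fun _ => rfl
  have hW1 : ∀ n, (st (n + 1)).2.1 = (st n).2.1 ⊓ perp (next (st n)) n := fun _ => rfl
  have hFm : Monotone fun n => (st n).1.1 :=
    monotone_nat_of_le_succ fun n => by rw [hF1]; exact le_sup_left
  have hWm : Antitone fun n => (st n).2.1 :=
    antitone_nat_of_succ_le fun n => by rw [hW1]; exact inf_le_left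
  refine ⟨fun n => vec (st n), fun n => (next (st n)).1, fun n => perp (next (st n)) n,
    fun n => hpick1 _ _, fun n => hperpF _ _, fun n i hi => ?_, fun n i hi => ?_⟩
  · have h1 : vec (st i) ∈ (st (i + 1)).1.1 :=
      Submodule.mem_sup_right (Submodule.mem_span_singleton_self _)
    exact hFm (Nat.succ_le_succ hi) h1
  · have h1 : vec (st i) ∈ (st (n + 1)).2.1 := hWm (Nat.succ_le_of_lt hi) (hpick _ _)
    rw [hW1] at h1
    exact h1.2

end BasicSequence

end Multinorm

end

theorem mainTheorem10 (p : ℝ≥0∞) [Fact (1 ≤ p)] (X : Type*) [NormedAddCommGroup X]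
    [NormedSpace ℝ X] [CompleteSpace X] (hX : ¬ FiniteDimensional ℝ X)
    (α : Multinorm.PMultinorm p X) (ε : ℕ → ℝ) (hε : ∀ n, 0 < ε n) :
    ∃ (x : ℕ → X) (hx : LinearIndependent ℝ x),
      (∀ n, ‖x n‖ = 1) ∧
      (∀ n, Multinorm.basisProjNorm α hx n ≤ ENNReal.ofReal (1 + ε n)) ∧
      Multinorm.IsPBasicSequence α x := by
  -- Truncating at `1` bounds all projections by `2`, since `ε` itself may be unbounded.
  have hε' : ∀ n, 0 < min (ε n) 1 := fun n => lt_min (hε n) one_pos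
  obtain ⟨x, F, W, hx1, hFW, hF, hW⟩ :=
    Multinorm.exists_seq_almostOrthogonal hX α (fun n => min (ε n) 1) hε'
  have hx : LinearIndependent ℝ x := by
    refine Multinorm.linearIndependent_of_notMem_span fun n hn => ?_
    have h0 : x n = 0 := by
      cases n with
      | zero => simpa using hn
      | succ n =>
        refine Submodule.disjoint_def.1 (hFW n).disjoint _
          (Submodule.span_le.2 ?_ hn) (hW n _ n.lt_succ_self)
        rintro _ ⟨i, hi, rfl⟩
        exact hF n i (Nat.le_of_lt_succ hi)
    simpa [h0] using hx1 n
  have hP : ∀ n, Multinorm.basisProjNorm α hx n ≤ ENNReal.ofReal (1 + min (ε n) 1) := fun n =>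
    (hFW n).basisProjNorm_le (hε' n).le hx n (hF n) (hW n)
  refine ⟨x, hx, hx1, fun n => (hP n).trans (ENNReal.ofReal_le_ofReal ?_), hx, ?_⟩
  · linarith [min_le_left (ε n) 1]
  · refine lt_of_le_of_lt (iSup_le fun n => (hP n).trans (ENNReal.ofReal_le_ofReal ?_))
      (ENNReal.ofReal_lt_top (r := 2))
    linarith [min_le_right (ε n) 1]
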